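/- Let $\mathsf{Q}$ be Robinson arithmetic: the deductive closure, in classical first-order logic with equality over the language $0, S, +, \times$, of the axioms $\forall x\,\neg\, Sx=0$; $\forall x\,\forall y\,(Sx=Sy\to x=y)$; $\forall x\,(x=0\lor\exists y\, Sy=x)$; $\forall x\; x+0=x$; $\forall x\,\forall y\; x+Sy=S(x+y)$; $\forall x\; x\times 0=0$; $\forall x\,\forall y\; x\times Sy=x+(x\times y)$. For $n\in\mathbb{N}$ let $\overline{n}$ be the numeral $S\cdots S0$ with $n$ occurrences of $S$, and write $\overline{\boldsymbol{x}}=(\overline{x_1},\dots,\overline{x_k})$ for $\boldsymbol{x}=(x_1,\dots,x_k)\in\mathbb{N}^k$. Theorem ($\mathsf{Q}$ correctly represents every computable function). Let $k\ge 0$ and let $f$ be a computable (that is, partial recursive) partial function from $\mathbb{N}^k$ to $\mathbb{N}$. Then there is a formula $\varphi(x_1,\dots,x_k,y)$ of this language, with no free variables other than $x_1,\dots,x_k,y$, such that for all $\boldsymbol{x}\in\mathbb{N}^k$ and $y\in\mathbb{N}$: 1. ($\varphi$ represents $f$ in $\mathsf{Q}$) if $f(\boldsymbol{x})$ is defined and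 equal to $y$, then $\mathsf{Q}\vdash \bigl(\exists!\,z\;\varphi(\overline{\boldsymbol{x}},z)\bigr)\land\varphi(\overline{\boldsymbol{x}},\overline{y})$; 2. ($\varphi$ is correct) the sentence $\varphi(\overline{\boldsymbol{x}},\overline{y})$ is true in the standard model $\mathbb{N}$ if and only if $f(\boldsymbol{x})$ is defined and equal to $y$. Here $\exists!\,z\;\psi(z)$ abbreviates $\exists z\,\bigl(\psi(z)\land\forall w\,(\psi(w)\to w=z)\bigr)$. -/

import Mathlib

namespace Arith

open FirstOrder FirstOrder.Language

/-- The function symbols `0`, `S`, `+`, `×`. -/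
inductive Func : ℕ → Type
  | zero : Func 0
  | succ : Func 1
  | add : Func 2
  | mul : Func 2

/-- The first-order language of arithmetic; equality is built into the logic. -/
def lang : FirstOrder.Language.{0, 0} where
  Functions := Func
  Relations := fun _ => Empty

/-- Formulas whose free variables are among `v 0, …, v (n - 1)`. -/
abbrev Fml (n : ℕ) : Type := lang.BoundedFormula Empty n

/-- Terms whose variables are among `v 0, …, v (n - 1)`. -/
abbrev Tm (n : ℕ) : Type := lang.Term (Empty ⊕ Fin n)

/-- The variable with number `i`. -/
def v {n : ℕ} (i : Fin n) : Tm n := Term.var (Sum.inr i)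

def zero {n : ℕ} : Tm n := Constants.term (L := lang) Func.zero

def succ {n : ℕ} (t : Tm n) : Tm n := Functions.apply₁ (L := lang) Func.succ t

def add {n : ℕ} (s t : Tm n) : Tm n := Functions.apply₂ (L := lang) Func.add s t

def mul {n : ℕ} (s t : Tm n) : Tm n := Functions.apply₂ (L := lang) Func.mul s t

/-- The numeral `S … S 0` of a natural number. -/
def num {n : ℕ} : ℕ → Tm n
  | 0 => zero
  | x + 1 => succ (num x)

/-- The standard interpretation of the language of arithmetic. -/
instance : lang.Structure ℕ where
  funMap := fun {_} f a =>
    match f with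
    | Func.zero => 0
    | Func.succ => a 0 + 1
    | Func.add => a 0 + a 1
    | Func.mul => a 0 * a 1
  RelMap := fun r _ => r.elim

/-! ### Substitution -/

/-- Simultaneous substitution of `σ i` for `v i` in a term. -/
def substTm {n m : ℕ} (σ : Fin n → Tm m) (t : Tm n) : Tm m :=
  t.subst (Sum.elim Empty.elim σ)

/-- Weakening: a term in `n` variables, seen as a term in `n + 1` variables. -/
def wkTm {n : ℕ} (t : Tm n) : Tm (n + 1) := substTm (fun i => v i.castSucc) t

/-- Simultaneous capture-avoiding substitution of `σ i` for the free variable `v i`.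
The quantifier `∀'` in a formula with free variables `v 0, …, v (n - 1)` binds `v n`. -/
def subst : {n m : ℕ} → (Fin n → Tm m) → Fml n → Fml m
  | _, _, _, .falsum => .falsum
  | _, _, σ, .equal s t => .equal (substTm σ s) (substTm σ t)
  | _, _, σ, .rel R ts => .rel R (fun i => substTm σ (ts i))
  | _, _, σ, .imp φ ψ => .imp (subst σ φ) (subst σ ψ)
  | _, m, σ, .all φ =>
      .all (subst (Fin.snoc (α := fun _ => Tm (m + 1)) (fun i => wkTm (σ i)) (v (Fin.last m))) φ)

/-- Weakening: a formula in `n` free variables, seen as a formula in `n + 1` free variables. -/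
def wk {n : ℕ} (φ : Fml n) : Fml (n + 1) := subst (fun i => v i.castSucc) φ

/-- Instantiation of the last free variable by a term. -/
def inst {n : ℕ} (φ : Fml (n + 1)) (t : Tm n) : Fml n :=
  subst (Fin.snoc (α := fun _ => Tm n) v t) φ

/-! ### Provability -/

/-- Classical natural deduction with equality. `Derives Γ φ`, for formulas in the free variables
`v 0, …, v (n - 1)`, says that `φ` is derivable from the assumptions `Γ`. Negation, conjunction,
disjunction and `∃` are Mathlib's abbreviations in terms of `⊥`, `→` and `∀`, so that the rules
for the latter suffice. In `allI` the quantified variable `v n` does not occur in `Γ`. -/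
inductive Derives : {n : ℕ} → Set (Fml n) → Fml n → Prop
  | ax {n : ℕ} {Γ : Set (Fml n)} {φ : Fml n} : φ ∈ Γ → Derives Γ φ
  | impI {n : ℕ} {Γ : Set (Fml n)} {φ ψ : Fml n} :
      Derives (insert φ Γ) ψ → Derives Γ (φ.imp ψ)
  | impE {n : ℕ} {Γ : Set (Fml n)} {φ ψ : Fml n} :
      Derives Γ (φ.imp ψ) → Derives Γ φ → Derives Γ ψ
  | raa {n : ℕ} {Γ : Set (Fml n)} {φ : Fml n} :
      Derives (insert φ.not Γ) ⊥ → Derives Γ φ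
  | allI {n : ℕ} {Γ : Set (Fml n)} {φ : Fml (n + 1)} :
      Derives (wk '' Γ) φ → Derives Γ φ.all
  | allE {n : ℕ} {Γ : Set (Fml n)} {φ : Fml (n + 1)} (t : Tm n) :
      Derives Γ φ.all → Derives Γ (inst φ t)
  | eqRefl {n : ℕ} {Γ : Set (Fml n)} (t : Tm n) : Derives Γ (t.bdEqual t)
  | eqSubst {n : ℕ} {Γ : Set (Fml n)} {s t : Tm n} (φ : Fml (n + 1)) :
      Derives Γ (s.bdEqual t) → Derives Γ (inst φ s) → Derives Γ (inst φ t)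

/-- The deductive closure of a set of axioms. -/
def theoryOf (A : lang.Theory) : lang.Theory := {φ | Derives A φ}

/-- The axioms of Robinson arithmetic. -/
inductive QAxiom : lang.Sentence → Prop
  /-- `∀ x, ¬ S x = 0` -/
  | S0 : QAxiom (∀' ∼((succ (v 0)).bdEqual zero))
  /-- `∀ x y, S x = S y → x = y` -/
  | S1 : QAxiom (∀' ∀' ((succ (v 0)).bdEqual (succ (v 1)) ⟹ (v 0).bdEqual (v 1)))
  /-- `∀ x, x = 0 ∨ ∃ y, S y = x` -/
  | S2 : QAxiom (∀' ((v 0).bdEqual zero ⊔ ∃' ((succ (v 1)).bdEqual (v 0))))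
  /-- `∀ x, x + 0 = x` -/
  | A0 : QAxiom (∀' ((add (v 0) zero).bdEqual (v 0)))
  /-- `∀ x y, x + S y = S (x + y)` -/
  | A1 : QAxiom (∀' ∀' ((add (v 0) (succ (v 1))).bdEqual (succ (add (v 0) (v 1)))))
  /-- `∀ x, x × 0 = 0` -/
  | M0 : QAxiom (∀' ((mul (v 0) zero).bdEqual zero))
  /-- `∀ x y, x × S y = x + x × y` -/
  | M1 : QAxiom (∀' ∀' ((mul (v 0) (succ (v 1))).bdEqual (add (v 0) (mul (v 0) (v 1)))))

/-- Robinson arithmetic. -/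
def Q : lang.Theory := theoryOf {φ | QAxiom φ}

/-! ### Representation of functions -/

/-- `∃! x, φ(x)`, that is `∃ x, φ(x) ∧ ∀ y, φ(y) → y = x`, where `x` is the last variable. -/
def exUnique {n : ℕ} (φ : Fml (n + 1)) : Fml n :=
  ∃' (φ ⊓ ∀' (subst (Fin.snoc (α := fun _ => Tm (n + 2)) (fun i => v i.castSucc.castSucc)
      (v (Fin.last (n + 1)))) φ ⟹
    (v (Fin.last (n + 1))).bdEqual (v (Fin.last n).castSucc)))

/-- `φ(x̄₁, …, x̄ₖ, y)`, with `y` left free (it is the only free variable). -/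
def app {k : ℕ} (φ : Fml (k + 1)) (x : List.Vector ℕ k) : Fml 1 :=
  subst (Fin.snoc (α := fun _ => Tm 1) (fun i => num (x.get i)) (v 0)) φ

/-- The sentence `φ(x̄₁, …, x̄ₖ, ȳ)`. -/
def appNum {k : ℕ} (φ : Fml (k + 1)) (x : List.Vector ℕ k) (y : ℕ) : lang.Sentence :=
  subst (Fin.snoc (α := fun _ => Tm 0) (fun i => num (x.get i)) (num y)) φ

/-- The formula `φ` represents the partial function `f` in the theory `T`: whenever `f x = y`,
`T` contains the sentence `(∃! y, φ(x̄, y)) ∧ φ(x̄, ȳ)`. -/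
def Represents (T : lang.Theory) {k : ℕ} (φ : Fml (k + 1)) (f : List.Vector ℕ k →. ℕ) : Prop :=
  ∀ (x : List.Vector ℕ k) (y : ℕ), y ∈ f x → exUnique (app φ x) ⊓ appNum φ x y ∈ T

/-- The partial function `f` is correctly represented in the theory `T`: some formula `φ`
represents it in `T`, and `φ(x̄, ȳ)` is true in `ℕ` if and only if `f x = y`. -/
def CorrectlyRepresented (T : lang.Theory) {k : ℕ} (f : List.Vector ℕ k →. ℕ) : Prop :=
  ∃ φ : Fml (k + 1), Represents T φ f ∧
    ∀ (x : List.Vector ℕ k) (y : ℕ), ℕ ⊨ appNum φ x y ↔ y ∈ f x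

end Arith

namespace Arith

open FirstOrder FirstOrder.Language

/-! ### Substitution in terms and formulas -/

section Substitution

variable {n m l : ℕ}

/-! Call a formula decided if `Q` proves each true numerical instance and refutes each false one.
Decided formulas contain the equations between polynomials and are closed under connectives and
bounded quantifiers (`Decided.ball`), because `Q` proves that anything below a numeral is one of
finitely many numerals (`le_num_elim`).

The graph of a partial recursive `f` has the form `∃ u, φ(x, y, u)` with `φ` decided and monotone in
`u` (`sigGraph_of_partrec`). Relations of this form are closed under conjunction, `∃` and bounded
`∀`. This covers composition and minimisation, and Gödel's β function reduces primitive recursion to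
it.

The formula `∃ u, φ` is already correct, but `Q` need not prove its value unique, since a
nonstandard `u` might vouch for another `y`. Hence `u` is required to bound `y` and to be the least
bound under which any value has a witness (`leastWitness`). Let `N` be a standard bound with a
witness. `Q` proves every `u` comparable with `N` (`le_total_num`). If `u ≤ N`, then `u` and `y` are
numerals and decidedness settles the case; if `N ≤ u`, leastness forces `u = N`
(`eq_num_of_leastWitness`). -/

@[simp] theorem substTm_v (σ : Fin n → Tm m) (i : Fin n) : substTm σ (v i) = σ i := rfl

@[simp] theorem substTm_zero (σ : Fin n → Tm m) : substTm σ zero = zero := by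
  simp only [substTm, zero, Constants.term, Term.subst]
  congr 1
  exact Subsingleton.elim _ _

@[simp] theorem substTm_succ (σ : Fin n → Tm m) (t : Tm n) :
    substTm σ (succ t) = succ (substTm σ t) := by
  simp only [substTm, succ, Functions.apply₁, Term.subst]
  congr 1
  funext i
  fin_cases i
  rfl

@[simp] theorem substTm_add (σ : Fin n → Tm m) (s t : Tm n) :
    substTm σ (add s t) = add (substTm σ s) (substTm σ t) := by
  simp only [substTm, add, Functions.apply₂, Term.subst]
  congr 1
  funext i
  fin_cases i <;> rfl

@[simp] theorem substTm_mul (σ : Fin n → Tm m) (s t : Tm n) :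
    substTm σ (mul s t) = mul (substTm σ s) (substTm σ t) := by
  simp only [substTm, mul, Functions.apply₂, Term.subst]
  congr 1
  funext i
  fin_cases i <;> rfl

@[simp] theorem substTm_num (σ : Fin n → Tm m) (x : ℕ) : substTm σ (num x) = num x := by
  induction x with
  | zero => exact substTm_zero σ
  | succ x ih => rw [num, substTm_succ, ih, num]

@[simp] theorem substTm_substTm (τ : Fin m → Tm l) (σ : Fin n → Tm m) (t : Tm n) :
    substTm τ (substTm σ t) = substTm (fun i => substTm τ (σ i)) t := by
  induction t with
  | var i => rcases i with i | i; exacts [i.elim, rfl]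
  | func f ts ih =>
    simp only [substTm, Term.subst] at ih ⊢
    congr 1
    funext i
    exact ih i

@[simp] theorem substTm_id (t : Tm n) : substTm v t = t := by
  induction t with
  | var i => rcases i with i | i; exacts [i.elim, rfl]
  | func f ts ih =>
    simp only [substTm, Term.subst] at ih ⊢
    congr 1
    funext i
    exact ih i

/-- The substitution `σ` under a quantifier. -/
def lift (σ : Fin n → Tm m) : Fin (n + 1) → Tm (m + 1) :=
  Fin.snoc (α := fun _ => Tm (m + 1)) (fun i => wkTm (σ i)) (v (Fin.last m))

/-- The substitution of `t` for the last variable that fixes the others. -/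
abbrev snocTm (σ : Fin n → Tm m) (t : Tm m) : Fin (n + 1) → Tm m :=
  Fin.snoc (α := fun _ => Tm m) σ t

@[simp] theorem lift_castSucc (σ : Fin n → Tm m) (i : Fin n) :
    lift σ i.castSucc = wkTm (σ i) := by
  simp [lift]

@[simp] theorem lift_last (σ : Fin n → Tm m) : lift σ (Fin.last n) = v (Fin.last m) := by
  simp [lift]

theorem substTm_wkTm (σ : Fin (n + 1) → Tm m) (t : Tm n) :
    substTm σ (wkTm t) = substTm (fun i => σ i.castSucc) t := by
  simp [wkTm]

theorem wkTm_substTm (σ : Fin n → Tm m) (t : Tm n) :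
    wkTm (substTm σ t) = substTm (fun i => wkTm (σ i)) t := by
  simp [wkTm]

@[simp] theorem substTm_lift_wkTm (σ : Fin n → Tm m) (t : Tm n) :
    substTm (lift σ) (wkTm t) = wkTm (substTm σ t) := by
  simp [substTm_wkTm, wkTm_substTm]

@[simp] theorem substTm_snoc_wkTm (σ : Fin n → Tm m) (s : Tm m) (t : Tm n) :
    substTm (snocTm σ s) (wkTm t) = substTm σ t := by
  simp [substTm_wkTm]

@[simp] theorem wkTm_v (i : Fin n) : wkTm (v i) = v i.castSucc := rfl

@[simp] theorem wkTm_num (x : ℕ) : wkTm (num x : Tm n) = num x := substTm_num _ x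

@[simp] theorem wkTm_succ (t : Tm n) : wkTm (succ t) = succ (wkTm t) := substTm_succ _ _

@[simp] theorem wkTm_add (s t : Tm n) : wkTm (add s t) = add (wkTm s) (wkTm t) :=
  substTm_add _ _ _

theorem lift_v : lift (v : Fin n → Tm n) = v := by
  funext i
  refine Fin.lastCases ?_ (fun i => ?_) i <;> simp

theorem substTm_lift_lift (τ : Fin m → Tm l) (σ : Fin n → Tm m) :
    (fun i => substTm (lift τ) (lift σ i)) = lift (fun i => substTm τ (σ i)) := by
  funext i
  refine Fin.lastCases ?_ (fun i => ?_) i <;> simp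

theorem subst_all (σ : Fin n → Tm m) (φ : Fml (n + 1)) : subst σ φ.all = (subst (lift σ) φ).all :=
  rfl

theorem subst_ex (σ : Fin n → Tm m) (φ : Fml (n + 1)) : subst σ φ.ex = (subst (lift σ) φ).ex :=
  rfl

theorem subst_imp (σ : Fin n → Tm m) (φ ψ : Fml n) :
    subst σ (φ.imp ψ) = (subst σ φ).imp (subst σ ψ) := rfl

theorem subst_not (σ : Fin n → Tm m) (φ : Fml n) : subst σ (∼φ) = ∼(subst σ φ) := rfl

theorem subst_sup (σ : Fin n → Tm m) (φ ψ : Fml n) :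
    subst σ (φ ⊔ ψ) = subst σ φ ⊔ subst σ ψ := rfl

theorem subst_bdEqual (σ : Fin n → Tm m) (s t : Tm n) :
    subst σ (s.bdEqual t) = (substTm σ s).bdEqual (substTm σ t) := rfl

theorem subst_subst (τ : Fin m → Tm l) (σ : Fin n → Tm m) (φ : Fml n) :
    subst τ (subst σ φ) = subst (fun i => substTm τ (σ i)) φ := by
  induction φ generalizing m l with
  | falsum => rfl
  | equal s t => simp [subst]
  | rel R ts => exact R.elim
  | imp φ ψ ih₁ ih₂ => simp [subst, ih₁, ih₂]
  | all φ ih => rw [subst_all, subst_all, ih, substTm_lift_lift, subst_all]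

@[simp] theorem subst_id (φ : Fml n) : subst v φ = φ := by
  induction φ with
  | falsum => rfl
  | equal s t => simp [subst]
  | rel R ts => exact R.elim
  | imp φ ψ ih₁ ih₂ => simp [subst, ih₁, ih₂]
  | all φ ih => rw [subst_all, lift_v, ih]

theorem subst_lift_wk (σ : Fin n → Tm m) (φ : Fml n) :
    subst (lift σ) (wk φ) = wk (subst σ φ) := by
  simp [wk, subst_subst, wkTm]

/-- Merges substitution under a quantifier and instantiation of the bound variable into one
simultaneous substitution, the form in which the quantifier rules are applied below. -/
theorem inst_subst_lift (σ : Fin n → Tm m) (φ : Fml (n + 1)) (t : Tm m) :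
    inst (subst (lift σ) φ) t = subst (snocTm σ t) φ := by
  rw [inst, subst_subst]
  congr 1
  funext i
  refine Fin.lastCases ?_ (fun i => ?_) i <;> simp [snocTm]

theorem subst_inst (σ : Fin n → Tm m) (φ : Fml (n + 1)) (t : Tm n) :
    subst σ (inst φ t) = inst (subst (lift σ) φ) (substTm σ t) := by
  rw [inst_subst_lift, inst, subst_subst]
  congr 1
  funext i
  refine Fin.lastCases ?_ (fun i => ?_) i <;> simp [snocTm]

theorem wk_bdEqual (s t : Tm n) : wk (s.bdEqual t) = (wkTm s).bdEqual (wkTm t) := rfl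

theorem inst_bdEqual (s t : Tm (n + 1)) (r : Tm n) :
    inst (s.bdEqual t) r = (substTm (snocTm v r) s).bdEqual (substTm (snocTm v r) t) := rfl

end Substitution

/-! ### Derived rules -/

namespace Derives

variable {n m : ℕ} {Γ Δ : Set (Fml n)} {φ ψ χ : Fml n} {s t r : Tm n}

theorem mono (h : Derives Γ φ) (hΓ : Γ ⊆ Δ) : Derives Δ φ := by
  induction h with
  | ax h => exact ax (hΓ h)
  | impI _ ih => exact impI (ih (Set.insert_subset_insert hΓ))
  | impE _ _ ih₁ ih₂ => exact impE (ih₁ hΓ) (ih₂ hΓ)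
  | raa _ ih => exact raa (ih (Set.insert_subset_insert hΓ))
  | allI _ ih => exact allI (ih (Set.image_mono hΓ))
  | allE t _ ih => exact allE t (ih hΓ)
  | eqRefl t => exact eqRefl t
  | eqSubst φ _ _ ih₁ ih₂ => exact eqSubst φ (ih₁ hΓ) (ih₂ hΓ)

/-- Needed to weaken derivations under quantifiers and to move closed derivations into open
contexts. The `allI` case works because `lift σ` commutes with weakening. -/
protected theorem subst (h : Derives Γ φ) (σ : Fin n → Tm m) :
    Derives (Arith.subst σ '' Γ) (Arith.subst σ φ) := by
  induction h generalizing m with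
  | ax h => exact ax (Set.mem_image_of_mem _ h)
  | impI _ ih =>
    refine impI ?_
    rw [← Set.image_insert_eq]
    exact ih σ
  | impE _ _ ih₁ ih₂ => exact impE (ih₁ σ) (ih₂ σ)
  | raa _ ih =>
    refine raa ?_
    rw [← subst_not, ← Set.image_insert_eq]
    exact ih σ
  | allI _ ih =>
    refine allI ?_
    have := ih (lift σ)
    simp only [Set.image_image, subst_lift_wk] at this ⊢
    exact this
  | allE t _ ih =>
    rw [subst_inst]
    exact allE _ (ih σ)
  | eqRefl t => exact eqRefl _
  | eqSubst φ _ _ ih₁ ih₂ =>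
    have := ih₂ σ
    rw [subst_inst] at this ⊢
    exact eqSubst _ (ih₁ σ) this

theorem weaken (h : Derives Γ φ) : Derives (insert ψ Γ) φ := h.mono (Set.subset_insert _ _)

theorem head : Derives (insert φ Γ) φ := ax (Set.mem_insert _ _)

theorem wk (h : Derives Γ φ) : Derives (Arith.wk '' Γ) (Arith.wk φ) := h.subst _

theorem cut (h : Derives Γ φ) (h' : Derives (insert φ Γ) ψ) : Derives Γ ψ := impE (impI h') h

theorem exfalso (h : Derives Γ ⊥) : Derives Γ φ := raa h.weaken

theorem absurd (h : Derives Γ φ) (h' : Derives Γ (∼φ)) : Derives Γ ψ := exfalso (impE h' h)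

theorem andI (h : Derives Γ φ) (h' : Derives Γ ψ) : Derives Γ (φ ⊓ ψ) :=
  impI (impE (impE head h.weaken) h'.weaken)

/-- The conjunction unfolds to `¬(φ → ¬ψ)`; assuming `¬φ`, the inner implication holds vacuously. -/
theorem andL (h : Derives Γ (φ ⊓ ψ)) : Derives Γ φ :=
  raa (impE h.weaken (impI (absurd head head.weaken)))

theorem andR (h : Derives Γ (φ ⊓ ψ)) : Derives Γ ψ :=
  raa (impE h.weaken (impI head.weaken))

theorem orL (h : Derives Γ φ) : Derives Γ (φ ⊔ ψ) := impI (absurd h.weaken head)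

theorem orR (h : Derives Γ ψ) : Derives Γ (φ ⊔ ψ) := impI h.weaken

theorem orE (h : Derives Γ (φ ⊔ ψ)) (h₁ : Derives (insert φ Γ) χ)
    (h₂ : Derives (insert ψ Γ) χ) : Derives Γ χ := by
  refine raa (impE head ?_)
  refine impE (impI h₂).weaken (impE h.weaken (impI (impE head.weaken ?_)))
  exact impE (impI h₁).weaken.weaken head

theorem exI {φ : Fml (n + 1)} (t : Tm n) (h : Derives Γ (inst φ t)) : Derives Γ φ.ex :=
  impI (impE (allE (φ := ∼φ) t head) h.weaken)

theorem exE {φ : Fml (n + 1)} (h : Derives Γ φ.ex)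
    (h' : Derives (insert φ (Arith.wk '' Γ)) (Arith.wk ψ)) : Derives Γ ψ := by
  refine raa (impE h.weaken (allI (impI ?_)))
  rw [Set.image_insert_eq]
  refine impE (head.weaken (φ := Arith.wk (∼ψ))) (h'.mono ?_)
  exact Set.insert_subset_insert (Set.subset_insert _ _)

theorem eqSymm (h : Derives Γ (s.bdEqual t)) : Derives Γ (t.bdEqual s) := by
  have := eqSubst ((v (Fin.last n)).bdEqual (wkTm s)) h (by simpa [inst_bdEqual] using eqRefl s)
  simpa [inst_bdEqual] using this

theorem eqTrans (h : Derives Γ (s.bdEqual t)) (h' : Derives Γ (t.bdEqual r)) :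
    Derives Γ (s.bdEqual r) := by
  have := eqSubst ((wkTm s).bdEqual (v (Fin.last n))) h' (by simpa [inst_bdEqual] using h)
  simpa [inst_bdEqual] using this

theorem eqSucc (h : Derives Γ (s.bdEqual t)) : Derives Γ ((succ s).bdEqual (succ t)) := by
  have := eqSubst ((wkTm (succ s)).bdEqual (succ (v (Fin.last n)))) h
    (by simpa [inst_bdEqual] using eqRefl _)
  simpa [inst_bdEqual] using this

theorem eqAdd {s' t' : Tm n} (h : Derives Γ (s.bdEqual t)) (h' : Derives Γ (s'.bdEqual t')) :
    Derives Γ ((add s s').bdEqual (add t t')) := by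
  have h₁ := eqSubst ((wkTm (add s s')).bdEqual (add (v (Fin.last n)) (wkTm s'))) h
    (by simpa [inst_bdEqual] using eqRefl _)
  have h₂ := eqSubst ((wkTm (add s s')).bdEqual (add (wkTm t) (v (Fin.last n)))) h'
    (by simpa [inst_bdEqual] using h₁)
  simpa [inst_bdEqual] using h₂

theorem eqMul {s' t' : Tm n} (h : Derives Γ (s.bdEqual t)) (h' : Derives Γ (s'.bdEqual t')) :
    Derives Γ ((mul s s').bdEqual (mul t t')) := by
  have h₁ := eqSubst ((wkTm (mul s s')).bdEqual (mul (v (Fin.last n)) (wkTm s'))) h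
    (by simpa [inst_bdEqual, wkTm] using eqRefl _)
  have h₂ := eqSubst ((wkTm (mul s s')).bdEqual (mul (wkTm t) (v (Fin.last n)))) h'
    (by simpa [inst_bdEqual, wkTm] using h₁)
  simpa [inst_bdEqual, wkTm] using h₂

/-- Replacement of equals in a substitution instance. -/
theorem replace {l : ℕ} {σ : Fin l → Tm n} {φ : Fml (l + 1)} (h : Derives Γ (s.bdEqual t))
    (h' : Derives Γ (Arith.subst (snocTm σ s) φ)) : Derives Γ (Arith.subst (snocTm σ t) φ) := by
  rw [← inst_subst_lift] at h' ⊢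
  exact eqSubst _ h h'

end Derives

/-! ### Robinson arithmetic in a context -/

/-- The axioms of Robinson arithmetic as formulas in `n` free variables. -/
def axiomsQ (n : ℕ) : Set (Fml n) := subst Fin.elim0 '' {φ | QAxiom φ}

theorem axiomsQ_zero : axiomsQ 0 = {φ | QAxiom φ} := by
  have : (subst Fin.elim0 : Fml 0 → Fml 0) = id := by
    funext φ
    rw [show (Fin.elim0 : Fin 0 → Tm 0) = v from Subsingleton.elim _ _, subst_id, id]
  rw [axiomsQ, this, Set.image_id]

/-- The axioms are sentences, so substitution only changes the number of variables in their context.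
In particular they remain available below a quantifier. -/
theorem subst_axiomsQ {n m : ℕ} (σ : Fin n → Tm m) : subst σ '' axiomsQ n = axiomsQ m := by
  rw [axiomsQ, axiomsQ, Set.image_image]
  simp only [subst_subst]
  congr 2
  funext φ
  congr 1
  exact Subsingleton.elim _ _

theorem axiomsQ_wk {n : ℕ} {Γ : Set (Fml n)} (h : axiomsQ n ⊆ Γ) :
    axiomsQ (n + 1) ⊆ wk '' Γ := by
  rw [← subst_axiomsQ (fun i : Fin n => v i.castSucc)]
  exact Set.image_mono h

theorem axiomsQ_insert {n : ℕ} {Γ : Set (Fml n)} {φ : Fml n} (h : axiomsQ n ⊆ Γ) :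
    axiomsQ n ⊆ insert φ Γ := h.trans (Set.subset_insert _ _)

section Numerals

variable {n : ℕ} {Γ : Set (Fml n)} {s t : Tm n}

theorem derives_axiom (hQ : axiomsQ n ⊆ Γ) {φ : Fml 0} (h : QAxiom φ) :
    Derives Γ (subst Fin.elim0 φ) := .ax (hQ ⟨φ, h, rfl⟩)

theorem derives_axiom_one (hQ : axiomsQ n ⊆ Γ) {φ : Fml 1} (h : QAxiom φ.all) (t : Tm n) :
    Derives Γ (subst (fun _ => t) φ) := by
  have := (derives_axiom hQ h).allE t
  erw [inst_subst_lift] at this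
  convert this using 2
  funext i
  fin_cases i
  rfl

theorem derives_axiom_two (hQ : axiomsQ n ⊆ Γ) {φ : Fml 2} (h : QAxiom φ.all.all) (s t : Tm n) :
    Derives Γ (subst ![s, t] φ) := by
  have := (derives_axiom_one hQ h s).allE t
  erw [inst_subst_lift] at this
  convert this using 2
  funext i
  fin_cases i <;> rfl

theorem succ_ne_zero (hQ : axiomsQ n ⊆ Γ) (t : Tm n) : Derives Γ (∼((succ t).bdEqual zero)) := by
  simpa [subst_not, subst_bdEqual] using derives_axiom_one hQ .S0 t

theorem succ_inj (hQ : axiomsQ n ⊆ Γ) (h : Derives Γ ((succ s).bdEqual (succ t))) :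
    Derives Γ (s.bdEqual t) :=
  .impE (by simpa [subst_imp, subst_bdEqual] using derives_axiom_two hQ .S1 s t) h

theorem zero_or_succ (hQ : axiomsQ n ⊆ Γ) (t : Tm n) :
    Derives Γ (t.bdEqual zero ⊔ ∃' ((succ (v (Fin.last n))).bdEqual (wkTm t))) := by
  have := derives_axiom_one hQ .S2 t
  rw [subst_sup, subst_ex, subst_bdEqual, subst_bdEqual] at this
  have h₀ : lift (fun _ : Fin 1 => t) 0 = wkTm t := lift_castSucc (n := 1) _ 0
  have h₁ : lift (fun _ : Fin 1 => t) 1 = v (Fin.last n) := lift_last (n := 1) _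
  simpa [h₀, h₁] using this

theorem add_zero (hQ : axiomsQ n ⊆ Γ) (t : Tm n) : Derives Γ ((add t zero).bdEqual t) := by
  simpa [subst_bdEqual] using derives_axiom_one hQ .A0 t

theorem add_succ (hQ : axiomsQ n ⊆ Γ) (s t : Tm n) :
    Derives Γ ((add s (succ t)).bdEqual (succ (add s t))) := by
  simpa [subst_bdEqual] using derives_axiom_two hQ .A1 s t

theorem mul_zero (hQ : axiomsQ n ⊆ Γ) (t : Tm n) : Derives Γ ((mul t zero).bdEqual zero) := by
  simpa [subst_bdEqual] using derives_axiom_one hQ .M0 t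

theorem mul_succ (hQ : axiomsQ n ⊆ Γ) (s t : Tm n) :
    Derives Γ ((mul s (succ t)).bdEqual (add s (mul s t))) := by
  simpa [subst_bdEqual] using derives_axiom_two hQ .M1 s t

theorem num_add (hQ : axiomsQ n ⊆ Γ) (x y : ℕ) :
    Derives Γ ((add (num x) (num y)).bdEqual (num (x + y))) := by
  induction y with
  | zero => exact add_zero hQ _
  | succ y ih => exact (add_succ hQ _ _).eqTrans ih.eqSucc

theorem num_mul (hQ : axiomsQ n ⊆ Γ) (x y : ℕ) :
    Derives Γ ((mul (num x) (num y)).bdEqual (num (x * y))) := by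
  induction y with
  | zero => exact mul_zero hQ _
  | succ y ih =>
    rw [Nat.mul_succ, Nat.add_comm (x * y)]
    exact (mul_succ hQ _ _).eqTrans (((Derives.eqRefl _).eqAdd ih).eqTrans (num_add hQ _ _))

theorem num_ne (hQ : axiomsQ n ⊆ Γ) {x y : ℕ} (h : x ≠ y) :
    Derives Γ (∼((num x).bdEqual (num y))) := by
  induction x generalizing y with
  | zero =>
    cases y with
    | zero => exact (h rfl).elim
    | succ y => exact .impI (Derives.head.eqSymm.absurd (succ_ne_zero (axiomsQ_insert hQ) _))
  | succ x ih =>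
    cases y with
    | zero => exact succ_ne_zero hQ _
    | succ y =>
      refine .impI ?_
      exact (succ_inj (axiomsQ_insert hQ) .head).absurd (ih (fun e => h (congrArg _ e))).weaken

/-- `s ≤ t`, that is `∃ z, z + s = t`. -/
def le (s t : Tm n) : Fml n :=
  ∃' ((add (v (Fin.last n)) (wkTm s)).bdEqual (wkTm t))

@[simp] theorem subst_le {m : ℕ} (σ : Fin n → Tm m) (s t : Tm n) :
    subst σ (le s t) = le (substTm σ s) (substTm σ t) := by
  rw [le, subst_ex, subst_bdEqual]
  simp [le]

theorem wk_le (s t : Tm n) : wk (le s t) = le (wkTm s) (wkTm t) := subst_le _ s t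

theorem leI (r : Tm n) (h : Derives Γ ((add r s).bdEqual t)) : Derives Γ (le s t) :=
  .exI r (by simpa [inst_bdEqual] using h)

theorem leE {ψ : Fml n} (h : Derives Γ (le s t))
    (h' : Derives (insert ((add (v (Fin.last n)) (wkTm s)).bdEqual (wkTm t)) (wk '' Γ)) (wk ψ)) :
    Derives Γ ψ := h.exE h'

theorem num_le (hQ : axiomsQ n ⊆ Γ) {x y : ℕ} (h : x ≤ y) : Derives Γ (le (num x) (num y)) := by
  obtain ⟨z, rfl⟩ := Nat.exists_eq_add_of_le' h
  exact leI _ (num_add hQ _ _)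

/-- Addition recurses on its right argument. As `le` puts its witness on the left, the same witness
`r` serves for a successor `t` and for its predecessor `y`. -/
theorem succ_add_of_succ_eq (hQ : axiomsQ n ⊆ Γ) {r y u : Tm n}
    (h : Derives Γ ((add r t).bdEqual u)) (hy : Derives Γ ((succ y).bdEqual t)) :
    Derives Γ ((succ (add r y)).bdEqual u) :=
  ((add_succ hQ _ _).eqSymm.eqTrans ((Derives.eqRefl _).eqAdd hy)).eqTrans h

theorem add_of_succ_eq (hQ : axiomsQ n ⊆ Γ) {r y u : Tm n}
    (h : Derives Γ ((add r y).bdEqual u)) (hy : Derives Γ ((succ y).bdEqual t)) :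
    Derives Γ ((add r t).bdEqual (succ u)) :=
  (((Derives.eqRefl _).eqAdd hy.eqSymm).eqTrans (add_succ hQ _ _)).eqTrans h.eqSucc

/-- Case distinction: `t` is zero or a successor. -/
theorem zero_or_succ_elim (hQ : axiomsQ n ⊆ Γ) (t : Tm n) {ψ : Fml n}
    (h₀ : Derives (insert (t.bdEqual zero) Γ) ψ)
    (h₁ : Derives (insert ((succ (v (Fin.last n))).bdEqual (wkTm t)) (wk '' Γ)) (wk ψ)) :
    Derives Γ ψ :=
  (zero_or_succ hQ t).orE h₀ (Derives.head.exE
    (h₁.mono (Set.insert_subset_insert (Set.image_mono (Set.subset_insert _ _)))))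

theorem succ_eq_wk {y : Tm n} (h : Derives Γ ((succ y).bdEqual t)) :
    Derives (wk '' Γ) ((succ (wkTm y)).bdEqual (wkTm t)) := by
  have := h.wk
  rwa [wk_bdEqual, wkTm_succ] at this

/-- A term bounded by a numeral equals one of the finitely many numerals up to it. -/
theorem le_num_elim (N : ℕ) {n : ℕ} {Γ : Set (Fml n)} {t : Tm n} {ψ : Fml n}
    (hQ : axiomsQ n ⊆ Γ) (h : Derives Γ (le t (num N)))
    (H : ∀ i ≤ N, Derives (insert (t.bdEqual (num i)) Γ) ψ) : Derives Γ ψ := by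
  induction N generalizing n with
  | zero =>
    refine zero_or_succ_elim hQ t (H 0 le_rfl) ?_
    have hle := h.wk
    rw [wk_le, wkTm_num] at hle
    refine leE hle.weaken ?_
    have hQ' := axiomsQ_wk (axiomsQ_insert (φ := (succ (v (Fin.last n))).bdEqual (wkTm t))
      (axiomsQ_wk hQ))
    rw [wkTm_num]
    -- A successor `t = S y` with `z + t = 0` would give `S (z + y) = 0`.
    exact (succ_add_of_succ_eq (axiomsQ_insert hQ') .head (succ_eq_wk .head).weaken).absurd
      (succ_ne_zero (axiomsQ_insert hQ') _)
  | succ N ih =>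
    refine zero_or_succ_elim hQ t (H 0 (Nat.zero_le _)) ?_
    have hle := h.wk
    rw [wk_le, wkTm_num] at hle
    have hQ' := axiomsQ_insert (φ := (succ (v (Fin.last n))).bdEqual (wkTm t)) (axiomsQ_wk hQ)
    -- The predecessor of `t` is at most `N` with the same witness, hence a numeral `i ≤ N`, and
    -- then `t` is `i + 1`.
    refine ih (t := v (Fin.last n)) hQ' (leE hle.weaken ?_) fun i hi => ?_
    · rw [wk_le, wkTm_num, wkTm_num]
      refine leI (v (Fin.last (n + 1))) (succ_inj (axiomsQ_insert (axiomsQ_wk hQ')) ?_)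
      exact succ_add_of_succ_eq (axiomsQ_insert (axiomsQ_wk hQ')) .head (succ_eq_wk .head).weaken
    · refine Derives.cut (φ := (wkTm t).bdEqual (num (i + 1))) ?_ ?_
      · exact Derives.head.weaken.eqSymm.eqTrans Derives.head.eqSucc
      · have := (H (i + 1) (Nat.succ_le_succ hi)).wk
        rw [Set.image_insert_eq, wk_bdEqual, wkTm_num] at this
        exact this.mono (Set.insert_subset_insert
          ((Set.subset_insert _ _).trans (Set.subset_insert _ _)))

/-- `Q` has no induction, so the induction on `N` is carried out outside; a successor `t` is
compared through its predecessor. -/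
theorem le_total_num (N : ℕ) {n : ℕ} {Γ : Set (Fml n)} (t : Tm n) (hQ : axiomsQ n ⊆ Γ) :
    Derives Γ (le t (num N) ⊔ le (num N) t) := by
  induction N generalizing n with
  | zero => exact .orR (leI t (add_zero hQ t))
  | succ N ih =>
    refine zero_or_succ_elim hQ t (.orL ?_) ?_
    · refine leI (num (N + 1)) ?_
      exact ((Derives.eqRefl _).eqAdd .head).eqTrans (add_zero (axiomsQ_insert hQ) _)
    · have hQ' := axiomsQ_insert (φ := (succ (v (Fin.last n))).bdEqual (wkTm t)) (axiomsQ_wk hQ)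
      change Derives _ (wk (le t (num (N + 1))) ⊔ wk (le (num (N + 1)) t))
      rw [wk_le, wk_le, wkTm_num]
      refine (ih (v (Fin.last n)) hQ').orE (.orL (leE .head ?_)) (.orR (leE .head ?_))
      · have hQ₂ := axiomsQ_wk (axiomsQ_insert (φ := le (v (Fin.last n)) (num N)) hQ')
        rw [wk_le, wkTm_num, wkTm_num]
        exact leI (v (Fin.last (n + 1))) (add_of_succ_eq (axiomsQ_insert hQ₂) .head
          (succ_eq_wk Derives.head.weaken).weaken)
      · have hQ₂ := axiomsQ_wk (axiomsQ_insert (φ := le (num N) (v (Fin.last n))) hQ')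
        rw [wk_le, wkTm_num, wkTm_num]
        refine leI (v (Fin.last (n + 1))) ?_
        refine ((add_succ (axiomsQ_insert hQ₂) _ _).eqTrans Derives.head.eqSucc).eqTrans ?_
        exact (succ_eq_wk Derives.head.weaken).weaken

end Numerals

/-! ### Semantics in the standard model -/

section Semantics

variable {n m : ℕ}

/-- The value of a term in the standard model. -/
abbrev val (t : Tm n) (x : Fin n → ℕ) : ℕ := t.realize (Sum.elim (default : Empty → ℕ) x)

/-- The truth of a formula in the standard model. -/
abbrev Holds (φ : Fml n) (x : Fin n → ℕ) : Prop := φ.Realize (default : Empty → ℕ) x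

@[simp] theorem val_v (i : Fin n) (x : Fin n → ℕ) : val (v i) x = x i := rfl

@[simp] theorem val_succ (t : Tm n) (x : Fin n → ℕ) : val (succ t) x = val t x + 1 := rfl

@[simp] theorem val_add (s t : Tm n) (x : Fin n → ℕ) : val (add s t) x = val s x + val t x := rfl

@[simp] theorem val_mul (s t : Tm n) (x : Fin n → ℕ) : val (mul s t) x = val s x * val t x := rfl

@[simp] theorem val_num (y : ℕ) (x : Fin n → ℕ) : val (num y) x = y := by
  induction y with
  | zero => rfl
  | succ y ih => rw [num, val_succ, ih]

theorem val_substTm (σ : Fin n → Tm m) (t : Tm n) (x : Fin m → ℕ) :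
    val (substTm σ t) x = val t (fun i => val (σ i) x) := by
  rw [val, substTm, Term.realize_subst, val]
  congr 1
  funext i
  rcases i with i | i
  exacts [i.elim, rfl]

@[simp] theorem val_wkTm (t : Tm n) (x : Fin n → ℕ) (z : ℕ) :
    val (wkTm t) (Fin.snoc x z : Fin (n + 1) → ℕ) = val t x := by
  simp [wkTm, val_substTm]

theorem holds_subst (σ : Fin n → Tm m) (φ : Fml n) (x : Fin m → ℕ) :
    Holds (subst σ φ) x ↔ Holds φ (fun i => val (σ i) x) := by
  induction φ generalizing m with
  | falsum => exact Iff.rfl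
  | equal s t => exact Eq.congr (val_substTm σ s x) (val_substTm σ t x)
  | rel R ts => exact R.elim
  | imp φ ψ ih₁ ih₂ => exact imp_congr (ih₁ σ x) (ih₂ σ x)
  | all φ ih =>
    refine forall_congr' fun z => (ih _ _).trans (iff_of_eq (congrArg _ ?_))
    funext i
    refine Fin.lastCases ?_ (fun i => ?_) i <;> simp

theorem models_iff_holds (φ : lang.Sentence) (x : Fin 0 → ℕ) : ℕ ⊨ φ ↔ Holds φ x := by
  rw [Sentence.Realize, Formula.Realize, Holds]
  refine iff_of_eq (congrArg₂ _ ?_ ?_) <;> exact Subsingleton.elim _ _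

theorem holds_bdEqual (s t : Tm n) (x : Fin n → ℕ) :
    Holds (s.bdEqual t) x ↔ val s x = val t x := Iff.rfl

theorem holds_le (s t : Tm n) (x : Fin n → ℕ) : Holds (le s t) x ↔ val s x ≤ val t x := by
  rw [Holds, le, BoundedFormula.realize_ex]
  have : ∀ z, BoundedFormula.Realize ((add (v (Fin.last n)) (wkTm s)).bdEqual (wkTm t))
      (default : Empty → ℕ) (Fin.snoc x z : Fin (n + 1) → ℕ) ↔ z + val s x = val t x := by
    intro z
    refine (holds_bdEqual _ _ _).trans ?_
    simp
  simp only [this]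
  exact ⟨fun ⟨z, hz⟩ => hz ▸ Nat.le_add_left _ _, fun h => ⟨_, Nat.sub_add_cancel h⟩⟩

/-- Bounded quantification `∀ z ≤ v j, φ`. -/
def ball (j : Fin n) (φ : Fml (n + 1)) : Fml n := ∀' (le (v (Fin.last n)) (v j.castSucc) ⟹ φ)

/-- Bounded quantification `∃ z ≤ v j, φ`. -/
def bex (j : Fin n) (φ : Fml (n + 1)) : Fml n := ∼(ball j (∼φ))

/-- Renaming of the free variables. -/
def rename (ρ : Fin n → Fin m) (φ : Fml n) : Fml m := subst (fun i => v (ρ i)) φ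

theorem holds_ball (j : Fin n) (φ : Fml (n + 1)) (x : Fin n → ℕ) :
    Holds (ball j φ) x ↔ ∀ z ≤ x j, Holds φ (Fin.snoc x z : Fin (n + 1) → ℕ) := by
  refine forall_congr' fun z => ?_
  rw [BoundedFormula.realize_imp]
  refine imp_congr ((holds_le _ _ _).trans ?_) Iff.rfl
  simp

theorem holds_not (φ : Fml n) (x : Fin n → ℕ) : Holds (∼φ) x ↔ ¬Holds φ x := Iff.rfl

theorem holds_bex (j : Fin n) (φ : Fml (n + 1)) (x : Fin n → ℕ) :
    Holds (bex j φ) x ↔ ∃ z ≤ x j, Holds φ (Fin.snoc x z : Fin (n + 1) → ℕ) := by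
  rw [bex, holds_not, holds_ball]
  simp only [holds_not, not_forall, not_not, exists_prop]

theorem holds_rename (ρ : Fin n → Fin m) (φ : Fml n) (x : Fin m → ℕ) :
    Holds (rename ρ φ) x ↔ Holds φ (fun i => x (ρ i)) := holds_subst _ _ _

end Semantics

/-! ### Formulas decided by Robinson arithmetic -/

section Decided

variable {n m : ℕ}

/-- Robinson arithmetic proves or refutes every numerical instance of `φ`, according to its truth
in the standard model. -/
def Decided (φ : Fml n) : Prop :=
  ∀ x : Fin n → ℕ,
    (Holds φ x → Derives (axiomsQ 0) (subst (fun i => num (x i)) φ)) ∧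
    (¬Holds φ x → Derives (axiomsQ 0) (∼(subst (fun i => num (x i)) φ)))

/-- Decidedness speaks about sentences; this makes it usable in any context with free variables that
contains the axioms. -/
theorem derives_of_closed {φ : Fml n} {x : Fin n → ℕ} {Γ : Set (Fml m)} (hQ : axiomsQ m ⊆ Γ)
    (h : Derives (axiomsQ 0) (subst (fun i => num (x i)) φ)) :
    Derives Γ (subst (fun i => num (x i)) φ) := by
  have := h.subst (Fin.elim0 : Fin 0 → Tm m)
  simp only [subst_axiomsQ, subst_subst, substTm_num] at this
  exact this.mono hQ

namespace Decided

theorem derives {φ : Fml n} (h : Decided φ) {x : Fin n → ℕ} {Γ : Set (Fml m)}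
    (hQ : axiomsQ m ⊆ Γ) (hx : Holds φ x) : Derives Γ (subst (fun i => num (x i)) φ) :=
  derives_of_closed hQ ((h x).1 hx)

theorem refutes {φ : Fml n} (h : Decided φ) {x : Fin n → ℕ} {Γ : Set (Fml m)}
    (hQ : axiomsQ m ⊆ Γ) (hx : ¬Holds φ x) : Derives Γ (∼(subst (fun i => num (x i)) φ)) :=
  derives_of_closed (φ := ∼φ) hQ ((h x).2 hx)

theorem falsum : Decided (⊥ : Fml n) := fun _ => ⟨fun h => h.elim, fun _ => .impI .head⟩

theorem imp {φ ψ : Fml n} (hφ : Decided φ) (hψ : Decided ψ) : Decided (φ.imp ψ) := by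
  intro x
  constructor
  · intro h
    by_cases hx : Holds φ x
    · exact .impI ((hψ x).1 (h hx)).weaken
    · exact .impI (Derives.head.absurd ((hφ x).2 hx).weaken)
  · intro h
    rw [Holds, BoundedFormula.realize_imp, Classical.not_imp] at h
    exact .impI ((Derives.impE .head ((hφ x).1 h.1).weaken).absurd ((hψ x).2 h.2).weaken)

theorem not {φ : Fml n} (hφ : Decided φ) : Decided (∼φ) := hφ.imp falsum

theorem inf {φ ψ : Fml n} (hφ : Decided φ) (hψ : Decided ψ) : Decided (φ ⊓ ψ) :=
  (hφ.imp hψ.not).not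

theorem sup {φ ψ : Fml n} (hφ : Decided φ) (hψ : Decided ψ) : Decided (φ ⊔ ψ) := hφ.not.imp hψ

theorem bdEqual {s t : Tm n}
    (hs : ∀ x, Derives (axiomsQ 0) ((substTm (fun i => num (x i)) s).bdEqual (num (val s x))))
    (ht : ∀ x, Derives (axiomsQ 0) ((substTm (fun i => num (x i)) t).bdEqual (num (val t x)))) :
    Decided (s.bdEqual t) := by
  intro x
  rw [subst_bdEqual, holds_bdEqual]
  constructor
  · intro h
    refine (hs x).eqTrans ?_
    rw [h]
    exact (ht x).eqSymm
  · intro h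
    refine .impI (Derives.absurd (φ := (num (val s x)).bdEqual (num (val t x))) ?_ ?_)
    · exact ((hs x).weaken.eqSymm.eqTrans .head).eqTrans (ht x).weaken
    · exact num_ne (axiomsQ_insert subset_rfl) h

theorem le (i j : Fin n) : Decided (le (v i) (v j)) := by
  intro x
  rw [subst_le, holds_le]
  simp only [substTm_v, val_v]
  constructor
  · exact fun h => num_le subset_rfl h
  · intro h
    -- A number at most `x j` would be one of the numerals up to `x j`, and all of these differ from
    -- `x i`.
    refine .impI (le_num_elim (x j) (axiomsQ_insert subset_rfl) .head fun a ha => ?_)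
    exact Derives.head.absurd (num_ne (axiomsQ_insert (axiomsQ_insert subset_rfl)) (by omega))

theorem rename {φ : Fml n} (h : Decided φ) (ρ : Fin n → Fin m) : Decided (rename ρ φ) := by
  intro x
  rw [holds_rename, Arith.rename, subst_subst]
  exact h _

end Decided

theorem subst_ball (σ : Fin n → Tm m) (j : Fin n) (φ : Fml (n + 1)) :
    subst σ (ball j φ) = ∀' (Arith.le (v (Fin.last m)) (wkTm (σ j)) ⟹ subst (lift σ) φ) := by
  change ∀' (subst (lift σ) (Arith.le _ _) ⟹ _) = _
  simp
  rfl

theorem ballE {σ : Fin n → Tm m} {j : Fin n} {φ : Fml (n + 1)} {Γ : Set (Fml m)} {s : Tm m}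
    (h : Derives Γ (subst σ (ball j φ))) (hs : Derives Γ (Arith.le s (σ j))) :
    Derives Γ (subst (snocTm σ s) φ) := by
  rw [subst_ball] at h
  have := h.allE s
  rw [← inst_subst_lift]
  refine this.impE ?_
  convert hs using 1
  exact (subst_le _ _ _).trans (by simp)

theorem snocTm_num (x : Fin n → ℕ) (z : ℕ) :
    snocTm (fun i => num (x i) : Fin n → Tm m) (num z) =
      fun i => num ((Fin.snoc x z : Fin (n + 1) → ℕ) i) := by
  funext i
  refine Fin.lastCases ?_ (fun i => ?_) i <;> simp [snocTm]

/-- By `le_num_elim` the bounded quantifier amounts to finitely many numerical instances; one false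
instance suffices for a refutation. -/
theorem Decided.ball {φ : Fml (n + 1)} (h : Decided φ) (j : Fin n) : Decided (ball j φ) := by
  intro x
  rw [holds_ball]
  constructor
  · intro hx
    rw [subst_ball]
    refine .allI (.impI ?_)
    rw [wkTm_num]
    have hQ := axiomsQ_insert (φ := Arith.le (v (Fin.last 0)) (num (x j)))
      (axiomsQ_wk (subset_refl (axiomsQ 0)))
    refine le_num_elim (x j) hQ .head fun a ha => ?_
    have e : lift (fun i => num (x i)) =
        snocTm (fun i => num (x i) : Fin n → Tm 1) (v (Fin.last 0)) := by
      funext i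
      refine Fin.lastCases ?_ (fun i => ?_) i <;> simp [snocTm]
    rw [e]
    refine Derives.replace Derives.head.eqSymm ?_
    rw [snocTm_num]
    exact h.derives (axiomsQ_insert hQ) (hx a ha)
  · intro hx
    push Not at hx
    obtain ⟨a, ha, hna⟩ := hx
    refine .impI (Derives.absurd
      (ballE (s := num a) .head (num_le (axiomsQ_insert subset_rfl) ha)) ?_)
    rw [snocTm_num]
    exact h.refutes (axiomsQ_insert subset_rfl) hna

theorem Decided.bex {φ : Fml (n + 1)} (h : Decided φ) (j : Fin n) : Decided (bex j φ) :=
  (h.not.ball j).not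

end Decided

/-! ### Representation of relations with a search bound -/

section Representation

variable {k : ℕ}

/-- `y ≤ u ∧ φ(x, y, u)` -/
def witness (φ : Fml (k + 2)) : Fml (k + 2) :=
  Arith.le (v (Fin.last k).castSucc) (v (Fin.last (k + 1))) ⊓ φ

/-- `∃ y ≤ u, y ≤ u ∧ φ(x, y, u)`, a formula in `x, u`. -/
def hasWitness (φ : Fml (k + 2)) : Fml (k + 1) :=
  bex (Fin.last k) (rename (Fin.snoc (α := fun _ => Fin (k + 2))
    (Fin.snoc (α := fun _ => Fin (k + 2)) (fun i => i.castSucc.castSucc) (Fin.last (k + 1)))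
      (Fin.last k).castSucc) (witness φ))

/-- The number `u'` equals `u`, or there is no witness below `u'`; a formula in `x, y, u, u'`. -/
def eqOrNoWitness (φ : Fml (k + 2)) : Fml (k + 3) :=
  (v (Fin.last (k + 2))).bdEqual (v (Fin.last (k + 1)).castSucc) ⊔
    ∼(rename (Fin.snoc (α := fun _ => Fin (k + 3)) (fun i => i.castSucc.castSucc.castSucc)
      (Fin.last (k + 2))) (hasWitness φ))

/-- The number `u` is the least bound for a witness `y` of `φ(x, y, u)`. -/
def leastWitness (φ : Fml (k + 2)) : Fml (k + 2) :=
  witness φ ⊓ ball (Fin.last (k + 1)) (eqOrNoWitness φ)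

variable {φ : Fml (k + 2)}

/-- The values of `x, y, u`. -/
abbrev snoc₂ (x : Fin k → ℕ) (y u : ℕ) : Fin (k + 2) → ℕ :=
  Fin.snoc (α := fun _ => ℕ) (Fin.snoc (α := fun _ => ℕ) x y) u

theorem holds_witness (x : Fin k → ℕ) (y u : ℕ) :
    Holds (witness φ) (snoc₂ x y u) ↔ y ≤ u ∧ Holds φ (snoc₂ x y u) := by
  rw [witness, Holds, BoundedFormula.realize_inf]
  refine and_congr ((holds_le _ _ _).trans ?_) Iff.rfl
  simp [snoc₂]

theorem holds_hasWitness (x : Fin k → ℕ) (u : ℕ) :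
    Holds (hasWitness φ) (Fin.snoc x u : Fin (k + 1) → ℕ) ↔
      ∃ y ≤ u, Holds φ (snoc₂ x y u) := by
  rw [hasWitness, holds_bex]
  simp only [Fin.snoc_last]
  refine exists_congr fun y => and_congr_right fun hy => ?_
  rw [holds_rename]
  have : (fun i => (Fin.snoc (Fin.snoc x u : Fin (k + 1) → ℕ) y : Fin (k + 2) → ℕ)
      ((Fin.snoc (α := fun _ => Fin (k + 2)) (Fin.snoc (α := fun _ => Fin (k + 2))
        (fun i => i.castSucc.castSucc) (Fin.last (k + 1)))
      (Fin.last k).castSucc : Fin (k + 2) → Fin (k + 2)) i)) = snoc₂ x y u := by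
    funext i
    refine Fin.lastCases ?_ (fun i => Fin.lastCases ?_ (fun i => ?_) i) i <;> simp [snoc₂]
  rw [this, holds_witness]
  simp [hy]

theorem holds_leastWitness (x : Fin k → ℕ) (y u : ℕ) :
    Holds (leastWitness φ) (snoc₂ x y u) ↔ (y ≤ u ∧ Holds φ (snoc₂ x y u)) ∧
      ∀ u' ≤ u, u' = u ∨ ¬∃ y' ≤ u', Holds φ (snoc₂ x y' u') := by
  rw [leastWitness, Holds, BoundedFormula.realize_inf]
  refine and_congr (holds_witness _ _ _) ((holds_ball _ _ _).trans ?_)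
  have hu : snoc₂ x y u (Fin.last (k + 1)) = u := by simp [snoc₂]
  rw [hu]
  refine forall₂_congr fun u' _ => ?_
  rw [eqOrNoWitness, Holds, BoundedFormula.realize_sup]
  refine or_congr ((holds_bdEqual _ _ _).trans ?_) (not_congr ((holds_rename _ _ _).trans ?_))
  · simp [snoc₂]
  · rw [← holds_hasWitness]
    refine iff_of_eq (congrArg _ ?_)
    funext i
    refine Fin.lastCases ?_ (fun i => ?_) i <;> simp [snoc₂]

theorem Decided.witness (h : Decided φ) : Decided (witness φ) := (Decided.le _ _).inf h

theorem Decided.hasWitness (h : Decided φ) : Decided (hasWitness φ) := (h.witness.rename _).bex _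

theorem decided_v_eq_v {n : ℕ} (i j : Fin n) : Decided ((v i).bdEqual (v j)) :=
  .bdEqual (fun _ => .eqRefl _) (fun _ => .eqRefl _)

theorem Decided.leastWitness (h : Decided φ) : Decided (leastWitness φ) :=
  h.witness.inf (((decided_v_eq_v _ _).sup (h.hasWitness.rename _).not).ball _)

variable {m : ℕ} {Γ : Set (Fml m)} {s t : Tm m} {x : Fin k → ℕ} {y N : ℕ}

/-- The terms substituted for `x, y, u`. -/
abbrev numSnoc₂ (x : Fin k → ℕ) (s t : Tm m) : Fin (k + 2) → Tm m :=
  snocTm (snocTm (fun i => num (x i)) s) t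

theorem numSnoc₂_num (y u : ℕ) :
    (numSnoc₂ x (num y) (num u) : _ → Tm m) = fun i => num (snoc₂ x y u i) := by
  rw [numSnoc₂, snocTm_num, snocTm_num]

theorem replace_numSnoc₂ {r : Tm m} (h : Derives Γ (s.bdEqual r))
    (h' : Derives Γ (subst (numSnoc₂ x s t) φ)) : Derives Γ (subst (numSnoc₂ x r t) φ) := by
  have key : ∀ s : Tm m, inst (subst (snocTm (snocTm (fun i => num (x i)) (v (Fin.last m)))
      (wkTm t)) φ) s = subst (numSnoc₂ x s t) φ := by
    intro s
    rw [inst, subst_subst]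
    congr 1
    funext i
    refine Fin.lastCases ?_ (fun i => Fin.lastCases ?_ (fun i => ?_) i) i <;> simp [snocTm]
  rw [← key] at h' ⊢
  exact .eqSubst _ h h'

/-- The bound `t` is one of finitely many numerals, and `s ≤ t` makes `s` a numeral too. Each
resulting instance is either true, and its value is `y` by uniqueness, or refuted by `Q`. -/
theorem eq_num_of_leastWitness_of_le (hφ : Decided φ) (hQ : axiomsQ m ⊆ Γ)
    (huniq : ∀ z u, Holds φ (snoc₂ x z u) → z = y)
    (h : Derives Γ (subst (numSnoc₂ x s t) (leastWitness φ))) (ht : Derives Γ (le t (num N))) :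
    Derives Γ (s.bdEqual (num y)) := by
  refine le_num_elim N hQ ht fun i _ => ?_
  have h₁ := Derives.replace Derives.head (h.weaken (ψ := t.bdEqual (num i)))
  have hs := (Derives.andL (Derives.andL h₁))
  rw [subst_le] at hs
  have hs : Derives (insert (t.bdEqual (num i)) Γ) (le s (num i)) := by
    simpa [snocTm] using hs
  refine le_num_elim i (axiomsQ_insert hQ) hs fun j _ => ?_
  have h₂ := replace_numSnoc₂ Derives.head (h₁.weaken (ψ := s.bdEqual (num j)))
  rw [numSnoc₂_num] at h₂
  by_cases hj : Holds (leastWitness φ) (snoc₂ x j i)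
  · have : j = y := huniq j i ((holds_leastWitness _ _ _).1 hj).1.2
    subst this
    exact .head
  · exact h₂.absurd (hφ.leastWitness.refutes (axiomsQ_insert (axiomsQ_insert hQ)) hj)

/-- Here `t` may be nonstandard. `N` is any standard bound with a witness, not necessarily the least
one. -/
theorem eq_num_of_leastWitness (hφ : Decided φ) (hQ : axiomsQ m ⊆ Γ)
    (huniq : ∀ z u, Holds φ (snoc₂ x z u) → z = y) (hy : y ≤ N) (hN : Holds φ (snoc₂ x y N))
    (h : Derives Γ (subst (numSnoc₂ x s t) (leastWitness φ))) :
    Derives Γ (s.bdEqual (num y)) := by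
  refine (le_total_num N t hQ).orE
    (eq_num_of_leastWitness_of_le hφ (axiomsQ_insert hQ) huniq h.weaken .head) ?_
  have hle : Derives (insert (le (num N) t) Γ)
      (le (num N) (numSnoc₂ x s t (Fin.last (k + 1)))) := by
    simpa [snocTm] using Derives.head
  -- The leastness clause, taken at `u' = N`: either `N = t`, or there is no witness below `N`.
  have h₁ := ballE (Derives.andR (h.weaken (ψ := le (num N) t))) hle
  refine Derives.orE h₁ ?_ ?_
  · rw [subst_bdEqual]
    simp only [substTm_v, snocTm, Fin.snoc_last, Fin.snoc_castSucc]
    have hQ' := axiomsQ_insert (φ := (num N).bdEqual t)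
      (axiomsQ_insert (φ := le (num N) t) hQ)
    refine eq_num_of_leastWitness_of_le hφ hQ' huniq h.weaken.weaken (N := N) ?_
    have := Derives.eqSubst (le (v (Fin.last m)) (num N)) Derives.head
      (by simpa [inst, snocTm] using num_le hQ' le_rfl)
    simpa [inst, snocTm] using this
  · have hQ' := axiomsQ_insert (φ := le (num N) t) hQ
    -- `Q` proves that `N` does have a witness, namely `y`.
    have h₂ : Derives (insert (le (num N) t) Γ) (subst
        (fun i => num ((Fin.snoc x N : Fin (k + 1) → ℕ) i)) (hasWitness φ)) :=
      hφ.hasWitness.derives hQ' ((holds_hasWitness _ _).2 ⟨y, hy, hN⟩)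
    refine h₂.weaken.absurd ?_
    convert Derives.head using 1
    rw [subst_not, rename, subst_subst]
    congr 2
    funext i
    refine Fin.lastCases ?_ (fun i => ?_) i <;> simp [snocTm]

/-- A functional relation that is the projection of a decided relation, monotone in the projected
variable, is correctly represented. -/
theorem correctlyRepresented_of_decided {f : List.Vector ℕ k →. ℕ} (hφ : Decided φ)
    (hmono : ∀ x a b, a ≤ b → Holds φ (Fin.snoc x a : Fin (k + 2) → ℕ) →
      Holds φ (Fin.snoc x b : Fin (k + 2) → ℕ))
    (hf : ∀ (x : List.Vector ℕ k) (y : ℕ), y ∈ f x ↔ ∃ u, Holds φ (snoc₂ x.get y u)) :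
    CorrectlyRepresented Q f := by
  have huniq : ∀ (x : List.Vector ℕ k) (y : ℕ), y ∈ f x →
      ∀ z u, Holds φ (snoc₂ x.get z u) → z = y := fun x y hy z u hz =>
    Part.mem_unique ((hf x z).2 ⟨u, hz⟩) hy
  have hleast : ∀ (x : List.Vector ℕ k) (y : ℕ), y ∈ f x ↔
      ∃ u, Holds (leastWitness φ) (snoc₂ x.get y u) := by
    intro x y
    constructor
    · intro hy
      obtain ⟨u₀, hu₀⟩ := (hf x y).1 hy
      -- Monotonicity allows the bound to be enlarged until it is at least `y`.
      have hex : ∃ u, y ≤ u ∧ Holds φ (snoc₂ x.get y u) :=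
        ⟨max u₀ y, le_max_right _ _, hmono _ _ _ (le_max_left _ _) hu₀⟩
      classical
      refine ⟨Nat.find hex, (holds_leastWitness _ _ _).2 ⟨Nat.find_spec hex, fun u' hu' => ?_⟩⟩
      refine or_iff_not_imp_left.2 fun hne => ?_
      rintro ⟨y', hy', hφ'⟩
      obtain rfl := huniq x y hy y' u' hφ'
      exact Nat.find_min hex (lt_of_le_of_ne hu' hne) ⟨hy', hφ'⟩
    · rintro ⟨u, hu⟩
      exact (hf x y).2 ⟨u, ((holds_leastWitness _ _ _).1 hu).1.2⟩
  have hsubst : ∀ {m : ℕ} (x : Fin k → ℕ) (s : Tm m),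
      subst (lift (snocTm (fun i => num (x i)) s)) (leastWitness φ) =
        subst (numSnoc₂ x (wkTm s) (v (Fin.last m))) (leastWitness φ) := by
    intro m x s
    congr 1
    funext i
    refine Fin.lastCases ?_ (fun i => Fin.lastCases ?_ (fun i => ?_) i) i <;> simp [snocTm]
  have hinst : ∀ {m : ℕ} (x : Fin k → ℕ) (s t : Tm m),
      inst (subst (lift (snocTm (fun i => num (x i)) s)) (leastWitness φ)) t =
        subst (numSnoc₂ x s t) (leastWitness φ) := fun x s t => inst_subst_lift _ _ _
  refine ⟨∃' (leastWitness φ), ?_, ?_⟩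
  · intro x y hy
    have hA : {φ | QAxiom φ} = axiomsQ 0 := axiomsQ_zero.symm
    change Derives {φ | QAxiom φ} _
    rw [hA]
    have hpos : Derives (axiomsQ 0) (appNum (∃' (leastWitness φ)) x y) := by
      obtain ⟨u, hu⟩ := (hleast x y).1 hy
      refine Derives.exI (num u) ?_
      refine Eq.mpr (congrArg _ (hinst x.get (num y) (num u))) ?_
      rw [numSnoc₂_num]
      exact hφ.leastWitness.derives subset_rfl hu
    refine .andI (.exI (num y) (.andI ?_ (.allI (.impI ?_)))) hpos
    · convert hpos using 1
      change subst _ (subst _ _) = subst _ _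
      rw [subst_subst]
      congr 1
      funext i
      refine Fin.lastCases ?_ (fun i => ?_) i
      · simp
        rfl
      · simp
    · refine Derives.cut (φ := subst (snocTm (fun i => num (x.get i)) (v (Fin.last 0)))
        (∃' (leastWitness φ))) ?_ ?_
      · convert Derives.head using 1
        change _ = subst _ (subst _ (subst _ _))
        rw [subst_subst, subst_subst]
        congr 1
        funext i
        refine Fin.lastCases ?_ (fun i => ?_) i
        · simp only [snocTm, Fin.snoc_last, substTm_v]
          rfl
        · simp [snocTm]
      · refine Derives.exE .head ?_
        rw [subst_bdEqual, wk_bdEqual]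
        simp only [substTm_v, Fin.snoc_last, Fin.snoc_castSucc, wkTm_num, wkTm_v]
        obtain ⟨u, hu⟩ := (hleast x y).1 hy
        rw [holds_leastWitness] at hu
        refine eq_num_of_leastWitness hφ (axiomsQ_insert (axiomsQ_wk (axiomsQ_insert
          (axiomsQ_insert (axiomsQ_wk subset_rfl))))) (huniq x y hy) hu.1.1 hu.1.2
          (t := v (Fin.last 1)) (Eq.mpr (congrArg _ ?_) Derives.head)
        exact (hsubst x.get (v (Fin.last 0))).symm
  · intro x y
    rw [hleast]
    refine (models_iff_holds _ default).trans ((holds_subst _ _ _).trans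
      (BoundedFormula.realize_ex.trans ?_))
    refine exists_congr fun u => iff_of_eq (congrArg (Holds (leastWitness φ)) ?_)
    funext i
    refine Fin.lastCases ?_ (fun i => Fin.lastCases ?_ (fun i => ?_) i) i <;> simp [snoc₂]

end Representation

/-! ### Existential relations -/

section Sig

variable {n m k : ℕ}

/-- Polynomial functions whose values Robinson arithmetic computes. -/
def Poly (p : (Fin n → ℕ) → ℕ) : Prop :=
  ∃ t : Tm n, ∀ x, val t x = p x ∧
    Derives (axiomsQ 0) ((substTm (fun i => num (x i)) t).bdEqual (num (p x)))

namespace Poly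

theorem var (i : Fin n) : Poly fun x => x i := ⟨v i, fun _ => ⟨rfl, .eqRefl _⟩⟩

theorem const (c : ℕ) : Poly fun _ : Fin n → ℕ => c := by
  refine ⟨num c, fun x => ⟨val_num c x, ?_⟩⟩
  rw [substTm_num]
  exact .eqRefl _

theorem add {p q : (Fin n → ℕ) → ℕ} : Poly p → Poly q → Poly fun x => p x + q x := by
  rintro ⟨s, hs⟩ ⟨t, ht⟩
  refine ⟨Arith.add s t, fun x => ⟨?_, ?_⟩⟩
  · rw [val_add, (hs x).1, (ht x).1]
  · rw [substTm_add]
    exact ((hs x).2.eqAdd (ht x).2).eqTrans (num_add subset_rfl _ _)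

theorem mul {p q : (Fin n → ℕ) → ℕ} : Poly p → Poly q → Poly fun x => p x * q x := by
  rintro ⟨s, hs⟩ ⟨t, ht⟩
  refine ⟨Arith.mul s t, fun x => ⟨?_, ?_⟩⟩
  · rw [val_mul, (hs x).1, (ht x).1]
  · rw [substTm_mul]
    exact ((hs x).2.eqMul (ht x).2).eqTrans (num_mul subset_rfl _ _)

end Poly

/-- Relations of the form `∃ u, φ(x, u)` for a decided formula `φ` that is monotone in `u`. -/
def Sig (R : (Fin n → ℕ) → Prop) : Prop :=
  ∃ φ : Fml (n + 1), Decided φ ∧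
    (∀ x a b, a ≤ b → Holds φ (Fin.snoc x a : Fin (n + 1) → ℕ) →
      Holds φ (Fin.snoc x b : Fin (n + 1) → ℕ)) ∧
    ∀ x, R x ↔ ∃ u, Holds φ (Fin.snoc x u : Fin (n + 1) → ℕ)

/-- The exchange of the last two variables. -/
def swapLast (n : ℕ) : Fin (n + 2) → Fin (n + 2) :=
  Fin.snoc (α := fun _ => Fin (n + 2)) (Fin.snoc (α := fun _ => Fin (n + 2))
    (fun i => i.castSucc.castSucc) (Fin.last (n + 1))) (Fin.last n).castSucc

theorem holds_rename_swapLast (φ : Fml (n + 2)) (x : Fin n → ℕ) (a b : ℕ) :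
    Holds (rename (swapLast n) φ) (snoc₂ x a b) ↔ Holds φ (snoc₂ x b a) := by
  rw [holds_rename]
  refine iff_of_eq (congrArg _ ?_)
  funext i
  refine Fin.lastCases ?_ (fun i => Fin.lastCases ?_ (fun i => ?_) i) i <;>
    simp [swapLast, snoc₂]

namespace Sig

theorem congr {R R' : (Fin n → ℕ) → Prop} (h : Sig R) (e : ∀ x, R' x ↔ R x) : Sig R' := by
  obtain ⟨φ, hφ, hm, hR⟩ := h
  exact ⟨φ, hφ, hm, fun x => (e x).trans (hR x)⟩

/-- Lets the closure proofs argue with the meaning `S` of the formula instead of its syntax. -/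
theorem of_holds_iff {R : (Fin n → ℕ) → Prop} {S : (Fin n → ℕ) → ℕ → Prop} {ψ : Fml (n + 1)}
    (hψ : Decided ψ) (key : ∀ x u, Holds ψ (Fin.snoc x u : Fin (n + 1) → ℕ) ↔ S x u)
    (hm : ∀ x a b, a ≤ b → S x a → S x b) (hR : ∀ x, R x ↔ ∃ u, S x u) : Sig R := by
  refine ⟨ψ, hψ, fun x a b hab => ?_, fun x => ?_⟩
  · rw [key, key]
    exact hm x a b hab
  · simp only [key]
    exact hR x

theorem rename {R : (Fin n → ℕ) → Prop} (h : Sig R) (ρ : Fin n → Fin m) :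
    Sig fun x : Fin m → ℕ => R fun i => x (ρ i) := by
  obtain ⟨φ, hφ, hm, hR⟩ := h
  have key : ∀ (x : Fin m → ℕ) (u : ℕ), Holds (Arith.rename (Fin.snoc
      (α := fun _ => Fin (m + 1)) (fun i => (ρ i).castSucc) (Fin.last m)) φ)
      (Fin.snoc x u : Fin (m + 1) → ℕ) ↔
        Holds φ (Fin.snoc (fun i => x (ρ i)) u : Fin (n + 1) → ℕ) := by
    intro x u
    rw [holds_rename]
    refine iff_of_eq (congrArg _ ?_)
    funext i
    refine Fin.lastCases ?_ (fun i => ?_) i <;> simp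
  exact of_holds_iff (hφ.rename _) key (fun x => hm _) fun x => hR _

theorem eq {p q : (Fin n → ℕ) → ℕ} : Poly p → Poly q → Sig fun x => p x = q x := by
  rintro ⟨s, hs⟩ ⟨t, ht⟩
  have hd : Decided (s.bdEqual t) := by
    refine .bdEqual (fun x => ?_) (fun x => ?_)
    · rw [(hs x).1]
      exact (hs x).2
    · rw [(ht x).1]
      exact (ht x).2
  have key : ∀ (x : Fin n → ℕ) (u : ℕ), Holds (Arith.rename Fin.castSucc (s.bdEqual t))
      (Fin.snoc x u : Fin (n + 1) → ℕ) ↔ p x = q x := by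
    intro x u
    rw [holds_rename, holds_bdEqual]
    simp only [Fin.snoc_castSucc]
    rw [(hs x).1, (ht x).1]
  exact of_holds_iff (hd.rename _) key (fun _ _ _ _ => id) fun x => by simp only [exists_const]

/-- By monotonicity the maximum of the two bounds serves both conjuncts. -/
theorem and {R R' : (Fin n → ℕ) → Prop} : Sig R → Sig R' → Sig fun x => R x ∧ R' x := by
  rintro ⟨φ, hφ, hm, hR⟩ ⟨ψ, hψ, hm', hR'⟩
  have key : ∀ x, Holds (φ ⊓ ψ) x ↔ Holds φ x ∧ Holds ψ x := fun x => BoundedFormula.realize_inf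
  refine ⟨_, hφ.inf hψ, fun x a b hab => ?_, fun x => ?_⟩
  · rw [key, key]
    exact And.imp (hm _ _ _ hab) (hm' _ _ _ hab)
  · simp only [key]
    rw [hR, hR']
    constructor
    · rintro ⟨⟨a, ha⟩, b, hb⟩
      exact ⟨max a b, hm _ _ _ (le_max_left _ _) ha, hm' _ _ _ (le_max_right _ _) hb⟩
    · rintro ⟨u, h, h'⟩
      exact ⟨⟨u, h⟩, u, h'⟩

/-- A single `u` bounds both `z` and the inner witness, so the new quantifier becomes a bounded one.
-/
theorem ex {R : (Fin n → ℕ) → ℕ → Prop}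
    (h : Sig fun x : Fin (n + 1) → ℕ => R (fun i => x i.castSucc) (x (Fin.last n))) :
    Sig fun x => ∃ z, R x z := by
  obtain ⟨φ, hφ, hm, hR⟩ := h
  have key : ∀ (x : Fin n → ℕ) (u : ℕ), Holds (bex (Fin.last n) (Arith.rename (swapLast n) φ))
      (Fin.snoc x u : Fin (n + 1) → ℕ) ↔ ∃ z ≤ u, Holds φ (snoc₂ x z u) := by
    intro x u
    rw [holds_bex]
    simp only [holds_rename_swapLast, Fin.snoc_last]
  have hR : ∀ x z, R x z ↔ ∃ u, Holds φ (snoc₂ x z u) := by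
    intro x z
    rw [← hR]
    simp
  refine of_holds_iff ((hφ.rename _).bex _) key (fun x a b hab => ?_) fun x => ?_
  · rintro ⟨z, hz, h⟩
    exact ⟨z, hz.trans hab, hm _ _ _ hab h⟩
  · simp only [hR]
    constructor
    · rintro ⟨z, u, h⟩
      exact ⟨max z u, z, le_max_left _ _, hm _ _ _ (le_max_right _ _) h⟩
    · rintro ⟨u, z, _, h⟩
      exact ⟨z, u, h⟩

/-- Collection: the supremum of the finitely many witnesses works for every `z`, by monotonicity. -/
theorem ball {R : (Fin n → ℕ) → ℕ → Prop} (j : Fin n)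
    (h : Sig fun x : Fin (n + 1) → ℕ => R (fun i => x i.castSucc) (x (Fin.last n))) :
    Sig fun x => ∀ z ≤ x j, R x z := by
  obtain ⟨φ, hφ, hm, hR⟩ := h
  have key : ∀ (x : Fin n → ℕ) (u : ℕ), Holds (Arith.ball j.castSucc
      (Arith.rename (swapLast n) φ)) (Fin.snoc x u : Fin (n + 1) → ℕ) ↔
        ∀ z ≤ x j, Holds φ (snoc₂ x z u) := by
    intro x u
    rw [holds_ball]
    simp only [holds_rename_swapLast, Fin.snoc_castSucc]
  have hR : ∀ x z, R x z ↔ ∃ u, Holds φ (snoc₂ x z u) := by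
    intro x z
    rw [← hR]
    simp
  refine of_holds_iff ((hφ.rename _).ball _) key (fun x a b hab => ?_) fun x => ?_
  · exact fun h z hz => hm _ _ _ hab (h z hz)
  · simp only [hR]
    constructor
    · intro h
      choose! u hu using h
      refine ⟨(Finset.range (x j + 1)).sup u, fun z hz => hm _ _ _ ?_ (hu z hz)⟩
      exact Finset.le_sup (f := u) (Finset.mem_range.2 (Nat.lt_succ_of_le hz))
    · rintro ⟨u, h⟩ z hz
      exact ⟨u, h z hz⟩

theorem exFin {R : (Fin m → ℕ) → (Fin n → ℕ) → Prop}
    (h : Sig fun x : Fin (m + n) → ℕ => R (fun i => x (i.castAdd n)) (fun i => x (i.natAdd m))) :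
    Sig fun x => ∃ w, R x w := by
  induction n with
  | zero =>
    refine congr h fun x => ?_
    constructor
    · rintro ⟨w, hw⟩
      rwa [Subsingleton.elim w fun i => x (i.natAdd m)] at hw
    · exact fun hw => ⟨_, hw⟩
  | succ n ih =>
    have h' : Sig fun x : Fin (m + n) → ℕ => ∃ z, R (fun i => x (i.castAdd n))
        (Fin.snoc (fun i => x (i.natAdd m)) z : Fin (n + 1) → ℕ) := by
      refine ex (congr h fun x => iff_of_eq (congrArg _ ?_))
      funext i
      refine Fin.lastCases ?_ (fun i => ?_) i
      · simp only [Fin.snoc_last]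
        rfl
      · simp only [Fin.snoc_castSucc]
        rfl
    refine congr (ih (R := fun x w => ∃ z, R x (Fin.snoc w z : Fin (n + 1) → ℕ)) h') fun x => ?_
    constructor
    · rintro ⟨w, hw⟩
      refine ⟨Fin.init w, w (Fin.last n), ?_⟩
      rwa [Fin.snoc_init_self]
    · rintro ⟨w, z, hw⟩
      exact ⟨_, hw⟩

theorem forall_fin {R : Fin n → (Fin m → ℕ) → Prop} (h : ∀ i, Sig (R i)) :
    Sig fun x => ∀ i, R i x := by
  induction n with
  | zero => exact congr (eq (.const 0) (.const 0)) fun x => by simp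
  | succ n ih => exact congr ((h 0).and (ih fun i => h i.succ)) fun x => Fin.forall_fin_succ

/-- The remainder is expressed by a quotient `q`, and its being smaller than the modulus by a slack
`s`, leaving only polynomial equations. -/
theorem beta (a b i p : Fin n) : Sig fun x => x a % ((x i + 1) * x b + 1) = x p := by
  have h : Sig fun x : Fin n → ℕ => ∃ q s,
      x a = ((x i + 1) * x b + 1) * q + x p ∧ x p + s = (x i + 1) * x b := by
    refine ex (ex (and (eq (.var _) ?_) (eq ((Poly.var _).add (.var _)) ?_)))
    · exact ((((Poly.var _).add (.const 1)).mul (.var _)).add (.const 1)).mul (.var _)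
        |>.add (.var _)
    · exact ((Poly.var _).add (.const 1)).mul (.var _)
  refine congr h fun x => ?_
  constructor
  · intro e
    have hlt := Nat.mod_lt (x a) (Nat.succ_pos ((x i + 1) * x b))
    refine ⟨x a / ((x i + 1) * x b + 1), (x i + 1) * x b - x p, ?_, ?_⟩
    · rw [← e, Nat.div_add_mod]
    · rw [Nat.succ_eq_add_one, e] at hlt
      omega
  · rintro ⟨q, s, h₁, h₂⟩
    rw [h₁, Nat.mul_add_mod]
    exact Nat.mod_eq_of_lt (by omega)

end Sig

/-! ### Graphs of partial recursive functions -/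

/-- The graph of `f` is an existential relation. -/
def SigGraph (f : List.Vector ℕ k →. ℕ) : Prop :=
  Sig fun x : Fin (k + 1) → ℕ =>
    x (Fin.last k) ∈ f (List.Vector.ofFn fun i => x i.castSucc)

theorem SigGraph.app {f : List.Vector ℕ k →. ℕ} (h : SigGraph f) (ρ : Fin k → Fin n) (j : Fin n) :
    Sig fun x : Fin n → ℕ => x j ∈ f (List.Vector.ofFn fun i => x (ρ i)) := by
  have := Sig.rename h (Fin.snoc (α := fun _ => Fin n) ρ j)
  simpa using this

theorem mem_mOfFn {α : Type*} {w : List.Vector α n} {g : Fin n → Part α} :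
    w ∈ List.Vector.mOfFn g ↔ ∀ i, w.get i ∈ g i := by
  induction n with
  | zero => simp [List.Vector.mOfFn, Part.pure_eq_some, Subsingleton.elim w List.Vector.nil]
  | succ n ih =>
    rw [Fin.forall_fin_succ]
    simp only [List.Vector.mOfFn, Part.bind_eq_bind, Part.mem_bind_iff, Part.pure_eq_some,
      Part.mem_some_iff, ih]
    constructor
    · rintro ⟨a, ha, b, hb, rfl⟩
      simpa using ⟨ha, hb⟩
    · rintro ⟨h₀, hs⟩
      refine ⟨w.get 0, h₀, w.tail, fun i => by simpa using hs i, ?_⟩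
      rw [List.Vector.get_zero, List.Vector.cons_head_tail]

/-- The intermediate values are quantified existentially as one tuple. -/
theorem SigGraph.comp {f : List.Vector ℕ n →. ℕ} {g : Fin n → List.Vector ℕ m →. ℕ}
    (hf : SigGraph f) (hg : ∀ i, SigGraph (g i)) :
    SigGraph fun v => (List.Vector.mOfFn fun i => g i v) >>= f := by
  have h : Sig fun x : Fin (m + 1) → ℕ => ∃ w : Fin n → ℕ,
      (∀ i, w i ∈ g i (List.Vector.ofFn fun j => x j.castSucc)) ∧
        x (Fin.last m) ∈ f (List.Vector.ofFn w) :=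
    Sig.exFin (Sig.and (Sig.forall_fin fun i => (hg i).app _ _) (hf.app _ _))
  refine h.congr fun x => ?_
  change _ ∈ (List.Vector.mOfFn fun i => g i (List.Vector.ofFn fun j => x j.castSucc)).bind f ↔ _
  refine Part.mem_bind_iff.trans ((exists_congr fun w => and_congr_left' mem_mOfFn).trans ?_)
  constructor
  · rintro ⟨w, hw, hy⟩
    exact ⟨w.get, hw, by rwa [List.Vector.ofFn_get]⟩
  · rintro ⟨w, hw, hy⟩
    exact ⟨.ofFn w, fun i => by simpa using hw i, hy⟩

/-- That `f` is nonzero below the minimum `m` must be stated positively. For `z ≤ m` and `c = f(z)`,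
the equation `z + c * j = m + l` is solvable in `j, l` exactly if `z = m` or `c ≠ 0`. -/
theorem SigGraph.rfind {f : List.Vector ℕ (n + 1) → ℕ}
    (hf : SigGraph (f : List.Vector ℕ (n + 1) →. ℕ)) :
    SigGraph fun v => Nat.rfind fun m => Part.some (decide (f (m ::ᵥ v) = 0)) := by
  have h : Sig fun x : Fin (n + 1) → ℕ =>
      (∃ c, c ∈ (f : List.Vector ℕ (n + 1) →. ℕ)
        (x (Fin.last n) ::ᵥ List.Vector.ofFn fun i => x i.castSucc) ∧ c = 0) ∧
      ∀ z ≤ x (Fin.last n), ∃ c, c ∈ (f : List.Vector ℕ (n + 1) →. ℕ)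
        (z ::ᵥ List.Vector.ofFn fun i => x i.castSucc) ∧
          ∃ j l, z + c * j = x (Fin.last n) + l := by
    refine .and (.ex (.and ?_ (.eq (.var _) (.const 0))))
      (.ball _ (.ex (.and ?_ (.ex (.ex (.eq ?_ ?_))))))
    · exact hf.app (Fin.cons (Fin.last n).castSucc fun i => i.castSucc.castSucc) _
    · exact hf.app (Fin.cons (Fin.last (n + 1)).castSucc
        fun i => i.castSucc.castSucc.castSucc) _
    · exact (Poly.var _).add ((Poly.var _).mul (.var _))
    · exact (Poly.var _).add (.var _)
  refine h.congr fun x => ?_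
  refine Nat.mem_rfind.trans ?_
  simp only [PFun.coe_val, Part.mem_some_iff, exists_eq_left]
  refine and_congr (by simp) ⟨fun h z hz => ?_, fun h z hz => ?_⟩
  · rcases hz.eq_or_lt with rfl | hz
    · exact ⟨0, 0, by simp⟩
    · have := h hz
      -- With `j = m`, the slack is `l = z + (c - 1) * m`.
      refine ⟨x (Fin.last n), z + (f (z ::ᵥ List.Vector.ofFn fun i => x i.castSucc) - 1) *
        x (Fin.last n), ?_⟩
      have hne : f (z ::ᵥ List.Vector.ofFn fun i => x i.castSucc) ≠ 0 := by simpa using this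
      obtain ⟨c, hc⟩ := Nat.exists_eq_succ_of_ne_zero hne
      rw [hc, Nat.succ_sub_one, Nat.succ_eq_add_one]
      ring
  · obtain ⟨j, l, e⟩ := h z hz.le
    have hne : f (z ::ᵥ List.Vector.ofFn fun i => x i.castSucc) ≠ 0 := by
      intro h0
      rw [h0] at e
      omega
    simpa using hne

/-- Gödel's β lemma: by the Chinese remainder theorem two numbers code any finite sequence. -/
theorem exists_beta (r : ℕ → ℕ) (h : ℕ) :
    ∃ a b, ∀ i ≤ h, a % ((i + 1) * b + 1) = r i := by
  let l := (List.range (h + 1)).map r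
  refine ⟨(Nat.unbeta l).unpair.1, (Nat.unbeta l).unpair.2, fun i hi => ?_⟩
  have := Nat.beta_unbeta_coe l ⟨i, by simp [l]; omega⟩
  simpa [Nat.beta, l] using this

/-- The pair `a, b` codes the course of values of the recursion. The auxiliary variables equal to
`0` and `z + 1` are there because `Sig.beta` takes only variables as arguments. -/
theorem SigGraph.prec {f : List.Vector ℕ n → ℕ} {g : List.Vector ℕ (n + 2) → ℕ}
    (hf : SigGraph (f : List.Vector ℕ n →. ℕ)) (hg : SigGraph (g : List.Vector ℕ (n + 2) →. ℕ)) :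
    SigGraph ((fun v : List.Vector ℕ (n + 1) => v.head.rec (f v.tail)
      fun y IH => g (y ::ᵥ IH ::ᵥ v.tail) : List.Vector ℕ (n + 1) → ℕ) :
        List.Vector ℕ (n + 1) →. ℕ) := by
  have h : Sig fun x : Fin (n + 2) → ℕ => ∃ a b,
      (∃ z p, z = 0 ∧ p ∈ (f : List.Vector ℕ n →. ℕ)
          (List.Vector.ofFn fun i => x i.succ.castSucc) ∧ a % ((z + 1) * b + 1) = p) ∧
      (∀ z ≤ x 0, ∃ p q z', z' = z + 1 ∧ a % ((z + 1) * b + 1) = p ∧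
        a % ((z' + 1) * b + 1) = q ∧ q ∈ (g : List.Vector ℕ (n + 2) →. ℕ)
          (z ::ᵥ p ::ᵥ List.Vector.ofFn fun i => x i.succ.castSucc)) ∧
      a % ((x 0 + 1) * b + 1) = x (Fin.last (n + 1)) := by
    refine .ex (.ex (.and (.ex (.ex (.and (.eq (.var _) (.const 0)) (.and ?_ (.beta _ _ _ _)))))
      (.and (.ball _ (.ex (.ex (.ex (.and (.eq (.var _) ((Poly.var _).add (.const 1)))
        (.and (.beta _ _ _ _) (.and (.beta _ _ _ _) ?_))))))) (.beta _ _ _ _))))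
    · exact hf.app _ _
    · exact hg.app (Fin.cons (Fin.last (n + 4)).castSucc.castSucc.castSucc
        (Fin.cons (Fin.last (n + 5)).castSucc.castSucc fun i =>
          i.succ.castSucc.castSucc.castSucc.castSucc.castSucc.castSucc.castSucc)) _
  refine h.congr fun x => ?_
  simp only [PFun.coe_val, Part.mem_some_iff, exists_eq_left, exists_eq_left', exists_and_left]
  set w := List.Vector.ofFn fun i : Fin n => x i.succ.castSucc
  have hhead : (List.Vector.ofFn fun i : Fin (n + 1) => x i.castSucc).head = x 0 := rfl
  have htail : (List.Vector.ofFn fun i : Fin (n + 1) => x i.castSucc).tail = w := by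
    simp [w]
  rw [hhead, htail]
  let r : ℕ → ℕ := fun y => Nat.rec (f w) (fun y IH => g (y ::ᵥ IH ::ᵥ w)) y
  change x (Fin.last (n + 1)) = r (x 0) ↔ _
  constructor
  · intro e
    -- The step clause ranges over `z ≤ x 0`, including `x 0` itself, so the code needs one value
    -- beyond `x 0`.
    obtain ⟨a, b, hab⟩ := exists_beta r (x 0 + 1)
    refine ⟨a, b, hab 0 (Nat.zero_le _), fun z hz => ?_, ?_⟩
    · rw [hab z (hz.trans (Nat.le_succ _)), hab (z + 1) (Nat.succ_le_succ hz)]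
    · rw [hab _ (Nat.le_succ _), e]
  · rintro ⟨a, b, h₀, hs, hy⟩
    have : ∀ z ≤ x 0, a % ((z + 1) * b + 1) = r z := by
      intro z hz
      induction z with
      | zero => exact h₀
      | succ z ih =>
        rw [hs z (Nat.le_of_succ_le hz), ih (Nat.le_of_succ_le hz)]
    rw [← hy, this _ le_rfl]

theorem sigGraph_of_primrec {f : List.Vector ℕ n → ℕ} (hf : Nat.Primrec' f) :
    SigGraph (f : List.Vector ℕ n →. ℕ) := by
  induction hf with
  | zero => exact (Sig.eq (.var (Fin.last 0)) (.const 0)).congr fun x => by simp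
  | succ =>
    refine (Sig.eq (.var (Fin.last 1)) ((Poly.var 0).add (.const 1))).congr fun x => ?_
    rw [PFun.coe_val, Part.mem_some_iff]
    rfl
  | get i =>
    refine (Sig.eq (.var (Fin.last _)) (.var i.castSucc)).congr fun x => ?_
    simp
  | comp g _ _ hf hg =>
    refine (SigGraph.comp hf hg).congr fun x => ?_
    change _ ↔ _ ∈ (List.Vector.mOfFn fun i => Part.some (g i _)).bind _
    rw [Vector.mOfFn_part_some]
    exact (iff_of_eq (congrArg (x (Fin.last _) ∈ ·) (Part.bind_some _ _))).symm
  | prec _ _ hf hg => exact hf.prec hg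

theorem sigGraph_of_partrec {f : List.Vector ℕ n →. ℕ} (hf : Nat.Partrec' f) : SigGraph f := by
  induction hf with
  | prim hf => exact sigGraph_of_primrec hf
  | comp g _ _ hf hg => exact hf.comp hg
  | rfind _ hf => exact hf.rfind

end Sig

end Arith

theorem mainTheorem11 {k : ℕ} (f : List.Vector ℕ k →. ℕ) (hf : Partrec f) :
    Arith.CorrectlyRepresented Arith.Q f := by
  obtain ⟨φ, hφ, hm, hR⟩ := Arith.sigGraph_of_partrec (Nat.Partrec'.part_iff.2 hf)
  refine Arith.correctlyRepresented_of_decided hφ hm fun x y => ?_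
  rw [← hR]
  simp
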